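/- Let $d\ge 1$, $\varepsilon>0$, $m>2$, $M>0$, and let $W:\mathbb R^d\to\mathbb R$ be an interaction kernel satisfying the following conditions. (W1) $W\in C^1(\mathbb R^d\setminus\{0\})$ and $W$ is radially symmetric: there is $\omega:(0,\infty)\to\mathbb R$ with $W(x)=\omega(\|x\|)$ for all $x\ne 0$. (W2) There is $C_\omega>0$ such that $\omega'(r)\le C_\omega r^{1-d}$ for $0<r\le 1$. (W4) $\omega'(r)>0$ for $0<r<1$, and $\omega'(r)=\omega(r)=0$ for $r\ge 1$. Set $(W*\rho)(x)=\int_{\mathbb R^d}W(x-y)\rho(y)\,dy$, let $$\mathcal Y_M=\{\rho\in L^1(\mathbb R^d)\cap L^m(\mathbb R^d):\ \rho\ge 0 \text{ a.e.},\ \|\rho\|_{L^1}=M\},$$ and let $$\mathcal E[\rho]=\frac{\varepsilon}{m-1}\int_{\mathbb R^d}\rho^m\,dx+\frac12\int_{\mathbb R^d}\rho\,(W*\rho)\,dx .$$ Let $\bar\rho\in\mathcal Y_M$ be a global minimizer of $\mathcal E$ over $\mathcal Y_M$ whose support (the support of the measure $\bar\rho\,dx$) is connected. Then $\bar\rho$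 is a stationary solution, in the weak sense, of $$\partial_t\rho=\varepsilon\Delta\rho^m+\nabla\cdot(\rho\nabla(W*\rho)).$$ That is, $\bar\rho\ge 0$ a.e., $\bar\rho\in L^1(\mathbb R^d)$, $\bar\rho^m\in H^1_{loc}(\mathbb R^d)$, the convolution $\nabla W*\bar\rho$ converges absolutely a.e., $\nabla W*\bar\rho$ and $\bar\rho\,(\nabla W*\bar\rho)$ belong to $L^1_{loc}(\mathbb R^d)$, and $$\varepsilon\nabla\bar\rho^m=-\bar\rho\,(\nabla W*\bar\rho)\quad\text{in the sense of distributions in }\mathbb R^d .$$ -/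

import Mathlib

open MeasureTheory Set Filter Topology
open scoped ENNReal

noncomputable section

namespace AggDiff

/-- The space `ℝ^d` with its Euclidean norm. -/
abbrev Space (d : ℕ) : Type := EuclideanSpace ℝ (Fin d)

/-! ### Assumptions on the interaction kernel -/

/-- (W1): `W` is `C¹` away from the origin and radially symmetric with profile `ω`. Only the
values of `ω` on `(0, ∞)` matter; the value of `W` at the origin is arbitrary. -/
def W1 {d : ℕ} (W : Space d → ℝ) (ω : ℝ → ℝ) : Prop :=
  ContDiffOn ℝ 1 W {0}ᶜ ∧ ∀ x : Space d, x ≠ 0 → W x = ω ‖x‖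

/-- (W2): `ω'(r) ≤ C r^{1-d}` for `0 < r ≤ 1`. -/
def W2 (d : ℕ) (ω : ℝ → ℝ) : Prop :=
  ∃ C : ℝ, 0 < C ∧ ∀ r : ℝ, 0 < r → r ≤ 1 → deriv ω r ≤ C * r ^ (1 - (d : ℤ))

/-- (W4): `ω' > 0` on `(0, 1)`, and `ω' = ω = 0` on `[1, ∞)`. -/
def W4 (ω : ℝ → ℝ) : Prop :=
  (∀ r : ℝ, 0 < r → r < 1 → 0 < deriv ω r) ∧
    ∀ r : ℝ, 1 ≤ r → deriv ω r = 0 ∧ ω r = 0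

/-! ### The free energy and its minimizers -/

/-- The convolution `W * ρ`. -/
def conv {d : ℕ} (W ρ : Space d → ℝ) (x : Space d) : ℝ :=
  ∫ y, W (x - y) * ρ y

/-- The convolution `∇W * ρ`, where `∇W` is the classical gradient of `W` (away from the
origin, hence almost everywhere). -/
def gradConv {d : ℕ} (W ρ : Space d → ℝ) (x : Space d) : Space d :=
  ∫ y, ρ y • gradient W (x - y)

/-- The free energy `ε/(m-1) ∫ ρ^m + 1/2 ∫ ρ (W * ρ)`. -/
def energy {d : ℕ} (ε m : ℝ) (W ρ : Space d → ℝ) : ℝ :=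
  ε / (m - 1) * (∫ x, ρ x ^ m) + 1 / 2 * ∫ x, ρ x * conv W ρ x

/-- The class of nonnegative densities in `L¹ ∩ L^m` of mass `M`. -/
def massClass (d : ℕ) (m M : ℝ) : Set (Space d → ℝ) :=
  {ρ | (0 ≤ᵐ[volume] ρ) ∧ Integrable ρ ∧ MemLp ρ (ENNReal.ofReal m) ∧ ∫ x, ‖ρ x‖ = M}

/-- `ρ` minimizes the free energy globally over the class of mass `M`. -/
def IsGlobalMinimizer {d : ℕ} (ε m M : ℝ) (W ρ : Space d → ℝ) : Prop :=
  ρ ∈ massClass d m M ∧ ∀ σ ∈ massClass d m M, energy ε m W ρ ≤ energy ε m W σ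

/-- The (essential) support of a density `ρ ≥ 0`: the support of the measure `ρ dx`. It does not
change when `ρ` is modified on a null set. -/
def essSupport {d : ℕ} (ρ : Space d → ℝ) : Set (Space d) :=
  (volume.withDensity fun x => ENNReal.ofReal (ρ x)).support

/-! ### Weak derivatives and stationary states -/

/-- Test functions: smooth with compact support in `ℝ^d`. -/
def IsTest {d : ℕ} (φ : Space d → ℝ) : Prop :=
  ContDiff ℝ ((⊤ : ℕ∞) : WithTop ℕ∞) φ ∧ HasCompactSupport φ

/-- `u ∈ L²_loc`. -/
def MemL2loc {d : ℕ} {F : Type*} [NormedAddCommGroup F] (u : Space d → F) : Prop :=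
  ∀ K : Set (Space d), IsCompact K → MemLp u 2 (volume.restrict K)

/-- `G` is the weak gradient of `u` on `ℝ^d`: `∫ u ∇φ = - ∫ φ G` for all test functions. -/
def HasWeakGradient {d : ℕ} (u : Space d → ℝ) (G : Space d → Space d) : Prop :=
  LocallyIntegrable u ∧ LocallyIntegrable G ∧
    ∀ φ : Space d → ℝ, IsTest φ → ∫ x, u x • gradient φ x = -∫ x, φ x • G x

/-- `u ∈ H¹_loc`. -/
def MemH1loc {d : ℕ} (u : Space d → ℝ) : Prop :=
  MemL2loc u ∧ ∃ G : Space d → Space d, MemL2loc G ∧ HasWeakGradient u G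

/-- `ρ ∈ L¹₊` is a stationary state of `∂ₜρ = ε Δρ^m + ∇·(ρ ∇(W * ρ))` in the weak sense.
The identity `ε ∇ρ^m = -ρ (∇W * ρ)` is tested against all test functions on `ℝ^d`; both sides
vanish as distributions off the support of `ρ`. -/
structure IsStationaryState {d : ℕ} (ε m : ℝ) (W ρ : Space d → ℝ) : Prop where
  nonneg : 0 ≤ᵐ[volume] ρ
  integrable : Integrable ρ
  pow_memH1loc : MemH1loc fun x => ρ x ^ m
  /-- the integral defining `∇W * ρ` converges almost everywhere -/
  gradConv_exists : ∀ᵐ x : Space d, Integrable fun y => ρ y • gradient W (x - y)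
  gradConv_locallyIntegrable : LocallyIntegrable (gradConv W ρ)
  /-- the right-hand side of the equation is a distribution -/
  flux_locallyIntegrable : LocallyIntegrable fun x => ρ x • gradConv W ρ x
  equation : ∀ φ : Space d → ℝ, IsTest φ →
    -(ε • ∫ x, (ρ x ^ m) • gradient φ x) = -∫ x, φ x • (ρ x • gradConv W ρ x)

end AggDiff

end

open MeasureTheory Set Filter Topology
open scoped ENNReal

noncomputable section

namespace AggDiff

/-! ### Radial integrability -/

/-! Put κ = εm/(m-1). The class of competitors is convex, so comparing the minimizer ρ with points
of a segment gives the Euler–Lagrange condition: κρ^(m-1) + W*ρ is at least a constant Λ almost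
everywhere, with equality where ρ ≠ 0 (`exists_firstVariation_eq`). The kernel increases to 0, so W
≤ 0 away from the origin. A positive Λ would then keep ρ above a positive constant on all of ℝ^d,
against finite mass. Hence Λ ≤ 0 and ρ^(m-1) = ((Λ - W*ρ)/κ)₊ (`exists_rpow_eq_max`).

The sign of Λ gives ρ^(m-1) ≤ κ⁻¹|W*ρ|. Since m-1 > 1 and W ∈ L¹, Young's inequality improves the
integrability of ρ by the factor m-1 at each use, and the constants stay under control up to L^∞
(`exists_ae_le_of_rpow_le_conv`). For bounded ρ the potential W*ρ is differentiable everywhere with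
gradient ∇W*ρ, because ∇W ∈ L¹ (`hasFDerivAt_conv`, `gradient_conv`).

Finally ρ^m = ((Λ - W*ρ)/κ)₊^p with p = m/(m-1) > 1. The map y ↦ y₊^p is differentiable across 0, so
the classical chain rule holds everywhere, free boundary included. As p-1 = 1/(m-1), the factor
y₊^(p-1) is ρ itself, and p/κ = 1/ε. This gives ε∇ρ^m = -ρ(∇W*ρ), and integration by parts makes it
weak. -/

/-- A continuous radial profile on `(0, ∞)` supported in `(0, 1)` and of size `O(r^{1-d})` gives
an integrable function on `ℝ^d`. -/
lemma integrable_radial {d : ℕ} (hd : 1 ≤ d) {f : ℝ → ℝ} {C : ℝ}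
    (hf : ContinuousOn f (Ioi 0)) (hC : ∀ r ∈ Ioo (0 : ℝ) 1, |r ^ (d - 1) * f r| ≤ C)
    (h1 : ∀ r, 1 ≤ r → f r = 0) : Integrable fun x : Space d => f ‖x‖ := by
  have : Nonempty (Fin d) := ⟨⟨0, hd⟩⟩
  rw [integrable_fun_norm_addHaar (volume : Measure (Space d)) (f := f)]
  simp only [finrank_euclideanSpace, Fintype.card_fin, smul_eq_mul]
  have hcont : ContinuousOn (fun r : ℝ => r ^ (d - 1) * f r) (Ioi 0) :=
    (continuous_pow _).continuousOn.mul hf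
  have hI : IntegrableOn (fun r : ℝ => r ^ (d - 1) * f r) (Ioo 0 1) := by
    refine IntegrableOn.of_bound (by simp)
      ((hcont.mono fun r hr => hr.1).aestronglyMeasurable measurableSet_Ioo) C ?_
    filter_upwards [ae_restrict_mem measurableSet_Ioo] with r hr
    exact hC r hr
  have hI' : IntegrableOn (fun r : ℝ => r ^ (d - 1) * f r) (Ici 1) := by
    refine (integrableOn_zero).congr_fun (fun r hr => ?_) measurableSet_Ici
    simp [h1 r hr]
  refine (hI.union hI').mono_set fun r hr => ?_
  rcases lt_or_ge r 1 with h | h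
  · exact Or.inl ⟨hr, h⟩
  · exact Or.inr h

/-! ### Sign, size and integrability of the kernel and its gradient -/

section Kernel

variable {d : ℕ} {W : Space d → ℝ} {ω : ℝ → ℝ}

lemma W1.contDiffOn_profile (hd : 1 ≤ d) (h : W1 W ω) : ContDiffOn ℝ 1 ω (Ioi 0) := by
  let e : Space d := EuclideanSpace.single ⟨0, hd⟩ 1
  have he : ‖e‖ = 1 := by simp [e]
  have he0 : e ≠ 0 := by rw [← norm_ne_zero_iff, he]; exact one_ne_zero
  have hmap : MapsTo (fun r : ℝ => r • e) (Ioi 0) {0}ᶜ := fun r hr =>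
    smul_ne_zero (ne_of_gt hr) he0
  have hsm : ContDiff ℝ 1 fun r : ℝ => r • e := contDiff_id.smul contDiff_const
  refine (h.1.comp hsm.contDiffOn hmap).congr fun r hr => ?_
  have hr' : (0 : ℝ) < r := hr
  simp [h.2 _ (hmap hr), norm_smul, he, abs_of_pos hr']

lemma W1.hasDerivAt_profile (hd : 1 ≤ d) (h : W1 W ω) {r : ℝ} (hr : 0 < r) :
    HasDerivAt ω (deriv ω r) r :=
  (((h.contDiffOn_profile hd).differentiableOn one_ne_zero).differentiableAt
    (Ioi_mem_nhds hr)).hasDerivAt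

lemma W1.continuousOn_deriv_profile (hd : 1 ≤ d) (h : W1 W ω) :
    ContinuousOn (deriv ω) (Ioi 0) :=
  (h.contDiffOn_profile hd).continuousOn_deriv_of_isOpen isOpen_Ioi le_rfl

lemma W4.deriv_nonneg (h : W4 ω) {r : ℝ} (hr : 0 < r) : 0 ≤ deriv ω r := by
  rcases lt_or_ge r 1 with h1 | h1
  · exact (h.1 r hr h1).le
  · exact (h.2 r h1).1.ge

lemma W1.even (h : W1 W ω) (x : Space d) : W (-x) = W x := by
  rcases eq_or_ne x 0 with rfl | hx
  · simp
  · rw [h.2 x hx, h.2 (-x) (neg_ne_zero.2 hx), norm_neg]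

lemma W1.hasFDerivAt (hd : 1 ≤ d) (h : W1 W ω) {x : Space d} (hx : x ≠ 0) :
    HasFDerivAt W (deriv ω ‖x‖ • fderiv ℝ (fun y : Space d => ‖y‖) x) x := by
  have hn : HasFDerivAt (fun y : Space d => ‖y‖) (fderiv ℝ (fun y : Space d => ‖y‖) x) x :=
    ((contDiffAt_norm ℝ hx).differentiableAt one_ne_zero).hasFDerivAt
  refine ((h.hasDerivAt_profile hd (norm_pos_iff.2 hx)).comp_hasFDerivAt x hn).congr_of_eventuallyEq
    ?_
  filter_upwards [isOpen_ne.mem_nhds hx] with y hy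
  exact h.2 y hy

lemma norm_fderiv_norm_le (x : Space d) : ‖fderiv ℝ (fun y : Space d => ‖y‖) x‖ ≤ 1 := by
  simpa using norm_fderiv_le_of_lipschitz ℝ (lipschitzWith_one_norm (E := Space d)) (x₀ := x)

lemma W1.norm_fderiv_le (hd : 1 ≤ d) (h : W1 W ω) (h4 : W4 ω) {x : Space d} (hx : x ≠ 0) :
    ‖fderiv ℝ W x‖ ≤ deriv ω ‖x‖ := by
  have h0 := h4.deriv_nonneg (norm_pos_iff.2 hx)
  rw [(h.hasFDerivAt hd hx).fderiv, norm_smul, Real.norm_of_nonneg h0]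
  exact mul_le_of_le_one_right h0 (norm_fderiv_norm_le x)

/-- The weight r^(d-1) is the polar Jacobian, which exactly cancels the allowed singularity of ω';
this is the form `integrable_radial` needs. -/
lemma W2.exists_pow_mul_le (hd : 1 ≤ d) (h : W2 d ω) :
    ∃ C : ℝ, ∀ r ∈ Ioo (0 : ℝ) 1, r ^ (d - 1) * deriv ω r ≤ C := by
  obtain ⟨C, -, hC⟩ := h
  refine ⟨C, fun r hr => ?_⟩
  have hp : (0 : ℝ) < r ^ (d - 1) := pow_pos hr.1 _
  calc r ^ (d - 1) * deriv ω r ≤ r ^ (d - 1) * (C * r ^ (1 - (d : ℤ))) :=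
        mul_le_mul_of_nonneg_left (hC r hr.1 hr.2.le) hp.le
    _ = C := by
        have : (1 - (d : ℤ)) = -((d - 1 : ℕ) : ℤ) := by push_cast [hd]; ring
        rw [this, zpow_neg, zpow_natCast]
        field_simp

/-- Mean value theorem on [r, 1] with ω(1) = 0. It transfers both the sign and the bound of ω' to ω.
-/
lemma exists_deriv_profile_eq (hd : 1 ≤ d) (h : W1 W ω) (h4 : W4 ω) {r : ℝ} (hr : r ∈ Ioo (0 : ℝ) 1) :
    ∃ s ∈ Ioo r 1, -ω r = deriv ω s * (1 - r) := by
  obtain ⟨s, hs, hs'⟩ := exists_deriv_eq_slope ω hr.2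
    ((h.contDiffOn_profile hd).continuousOn.mono fun t ht => hr.1.trans_le ht.1)
    (((h.contDiffOn_profile hd).differentiableOn one_ne_zero).mono fun t ht => hr.1.trans ht.1)
  refine ⟨s, hs, ?_⟩
  have : (1 : ℝ) - r ≠ 0 := (sub_pos.2 hr.2).ne'
  rw [hs', (h4.2 1 le_rfl).2, div_mul_cancel₀ _ this, zero_sub]

lemma profile_nonpos (hd : 1 ≤ d) (h : W1 W ω) (h4 : W4 ω) {r : ℝ} (hr : 0 < r) : ω r ≤ 0 := by
  rcases lt_or_ge r 1 with h1 | h1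
  · obtain ⟨s, hs, he⟩ := exists_deriv_profile_eq hd h h4 ⟨hr, h1⟩
    have := mul_nonneg (h4.deriv_nonneg (hr.trans hs.1)) (sub_nonneg.2 h1.le)
    linarith
  · exact (h4.2 r h1).2.le

lemma kernel_nonpos (hd : 1 ≤ d) (h : W1 W ω) (h4 : W4 ω) {x : Space d} (hx : x ≠ 0) :
    W x ≤ 0 := by
  rw [h.2 x hx]; exact profile_nonpos hd h h4 (norm_pos_iff.2 hx)

lemma ae_ne_zero (hd : 1 ≤ d) : ∀ᵐ x : Space d, x ≠ 0 := by
  have : Nonempty (Fin d) := ⟨⟨0, hd⟩⟩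
  exact Measure.ae_ne volume 0

lemma integrable_kernel (hd : 1 ≤ d) (h : W1 W ω) (h2 : W2 d ω) (h4 : W4 ω) : Integrable W := by
  obtain ⟨C, hC⟩ := h2.exists_pow_mul_le hd
  have : Integrable fun x : Space d => ω ‖x‖ := by
    refine integrable_radial hd (C := C) (h.contDiffOn_profile hd).continuousOn (fun r hr => ?_)
      fun r hr => (h4.2 r hr).2
    obtain ⟨s, hs, he⟩ := exists_deriv_profile_eq hd h h4 hr
    have hs0 := h4.deriv_nonneg (hr.1.trans hs.1)
    have hs1 : s ∈ Ioo (0 : ℝ) 1 := ⟨hr.1.trans hs.1, hs.2⟩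
    have hp : (0 : ℝ) < r ^ (d - 1) := pow_pos hr.1 _
    rw [abs_mul, abs_of_pos hp, abs_of_nonpos (profile_nonpos hd h h4 hr.1), he]
    -- Since r < s, the weight may be moved to the intermediate point s, where the bound on ω'
    -- applies. No power of r is integrated, so no dimension is special.
    calc r ^ (d - 1) * (deriv ω s * (1 - r)) ≤ r ^ (d - 1) * deriv ω s :=
          mul_le_mul_of_nonneg_left (mul_le_of_le_one_right hs0 (by linarith [hr.1])) hp.le
      _ ≤ s ^ (d - 1) * deriv ω s :=
          mul_le_mul_of_nonneg_right (pow_le_pow_left₀ hr.1.le hs.1.le _) hs0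
      _ ≤ C := hC s hs1
  refine this.congr ?_
  filter_upwards [ae_ne_zero hd] with x hx
  exact (h.2 x hx).symm

lemma integrable_fderiv_kernel (hd : 1 ≤ d) (h : W1 W ω) (h2 : W2 d ω) (h4 : W4 ω) :
    Integrable (fderiv ℝ W) := by
  obtain ⟨C, hC⟩ := h2.exists_pow_mul_le hd
  have : Integrable fun x : Space d => deriv ω ‖x‖ := by
    refine integrable_radial hd (C := C) (h.continuousOn_deriv_profile hd) (fun r hr => ?_)
      fun r hr => (h4.2 r hr).1
    rw [abs_of_nonneg (mul_nonneg (pow_pos hr.1 _).le (h4.deriv_nonneg hr.1))]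
    exact hC r hr
  refine this.mono' (measurable_fderiv ℝ W).aestronglyMeasurable ?_
  filter_upwards [ae_ne_zero hd] with x hx
  exact h.norm_fderiv_le hd h4 hx

/-! ### Truncation of the kernel near the origin -/

/-- A continuous cut-off vanishing on `(-∞, 1/n]` and equal to `1` on `[2/n, ∞)`. -/
def cutoff (n : ℕ) (s : ℝ) : ℝ := max 0 (min 1 (n * s - 1))

lemma cutoff_nonneg (n : ℕ) (s : ℝ) : 0 ≤ cutoff n s := le_max_left _ _

lemma cutoff_le_one (n : ℕ) (s : ℝ) : cutoff n s ≤ 1 := max_le zero_le_one (min_le_left _ _)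

lemma continuous_cutoff (n : ℕ) : Continuous (cutoff n) := by unfold cutoff; fun_prop

lemma cutoff_eq_zero {n : ℕ} {s : ℝ} (h : n * s ≤ 1) : cutoff n s = 0 :=
  max_eq_left ((min_le_right _ _).trans (by linarith))

lemma cutoff_eq_one {n : ℕ} {s : ℝ} (h : 2 ≤ n * s) : cutoff n s = 1 := by
  rw [cutoff, min_eq_left (by linarith), max_eq_right zero_le_one]

/-- The profile of the truncated kernel. -/
def truncProfile (ω : ℝ → ℝ) (n : ℕ) (r : ℝ) : ℝ := ∫ s in (1 : ℝ)..r, cutoff n s * deriv ω s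

/-- The kernel with its singularity at the origin removed. -/
def truncKernel (d : ℕ) (ω : ℝ → ℝ) (n : ℕ) (x : Space d) : ℝ := truncProfile ω n ‖x‖

lemma continuous_cutoff_mul_deriv (hd : 1 ≤ d) (h : W1 W ω) (n : ℕ) :
    Continuous fun s => cutoff n s * deriv ω s := by
  rw [continuous_iff_continuousAt]
  intro s
  rcases lt_or_ge 0 s with hs | hs
  · exact (continuous_cutoff n).continuousAt.mul
      ((h.continuousOn_deriv_profile hd).continuousAt (Ioi_mem_nhds hs))
  · have hev : ∀ᶠ t in 𝓝 s, (n : ℝ) * t < 1 := by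
      have hc : Continuous fun t : ℝ => (n : ℝ) * t := by fun_prop
      refine hc.continuousAt.eventually_lt_const (lt_of_le_of_lt ?_ zero_lt_one)
      exact mul_nonpos_of_nonneg_of_nonpos n.cast_nonneg hs
    refine (continuousAt_const (y := (0 : ℝ))).congr ?_
    filter_upwards [hev] with t ht
    rw [cutoff_eq_zero ht.le, zero_mul]

lemma hasDerivAt_truncProfile (hd : 1 ≤ d) (h : W1 W ω) (n : ℕ) (r : ℝ) :
    HasDerivAt (truncProfile ω n) (cutoff n r * deriv ω r) r :=
  ((continuous_cutoff_mul_deriv hd h n).integral_hasStrictDerivAt 1 r).hasDerivAt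

lemma contDiff_truncProfile (hd : 1 ≤ d) (h : W1 W ω) (n : ℕ) :
    ContDiff ℝ 1 (truncProfile ω n) := by
  rw [contDiff_one_iff_deriv]
  refine ⟨fun r => (hasDerivAt_truncProfile hd h n r).differentiableAt, ?_⟩
  rw [show deriv (truncProfile ω n) = fun s => cutoff n s * deriv ω s from
    funext fun r => (hasDerivAt_truncProfile hd h n r).deriv]
  exact continuous_cutoff_mul_deriv hd h n

lemma truncProfile_eq_zero (h4 : W4 ω) (n : ℕ) {r : ℝ} (hr : 1 ≤ r) : truncProfile ω n r = 0 := by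
  refine (intervalIntegral.integral_congr (g := fun _ => (0 : ℝ)) fun s hs => ?_).trans (by simp)
  rw [uIcc_of_le hr] at hs
  simp [(h4.2 s hs.1).1]

lemma integral_deriv_profile (hd : 1 ≤ d) (h : W1 W ω) (h4 : W4 ω) {r : ℝ} (hr : 0 < r)
    (hr1 : r < 1) : ∫ s in (1 : ℝ)..r, deriv ω s = ω r := by
  have hsub : uIcc 1 r ⊆ Ioi (0 : ℝ) := by
    rw [uIcc_of_ge hr1.le]; exact fun s hs => hr.trans_le hs.1
  rw [intervalIntegral.integral_eq_sub_of_hasDerivAt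
    (fun s hs => h.hasDerivAt_profile hd (hsub hs))
    ((h.continuousOn_deriv_profile hd).mono hsub).intervalIntegrable, (h4.2 1 le_rfl).2, sub_zero]

lemma truncProfile_eq (hd : 1 ≤ d) (h : W1 W ω) (h4 : W4 ω) {n : ℕ} {r : ℝ} (hr : 0 < r)
    (hn : 2 ≤ n * r) : truncProfile ω n r = ω r := by
  rcases lt_or_ge r 1 with h1 | h1
  · rw [← integral_deriv_profile hd h h4 hr h1]
    refine intervalIntegral.integral_congr fun s hs => ?_
    rw [uIcc_of_ge h1.le] at hs
    have : 2 ≤ (n : ℝ) * s := hn.trans (mul_le_mul_of_nonneg_left hs.1 n.cast_nonneg)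
    simp [cutoff_eq_one this]
  · rw [truncProfile_eq_zero h4 n h1, (h4.2 r h1).2]

/-- Both profiles are integrals from 1, and 0 ≤ cutoff · ω' ≤ ω'. This supplies the dominating
function when the truncation is removed. -/
lemma abs_truncProfile_le (hd : 1 ≤ d) (h : W1 W ω) (h4 : W4 ω) (n : ℕ) {r : ℝ} (hr : 0 < r) :
    |truncProfile ω n r| ≤ |ω r| := by
  rcases lt_or_ge r 1 with h1 | h1
  · have hsub : Icc r 1 ⊆ Ioi (0 : ℝ) := fun s hs => hr.trans_le hs.1
    have hI : IntervalIntegrable (deriv ω) volume r 1 := by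
      refine ContinuousOn.intervalIntegrable ((h.continuousOn_deriv_profile hd).mono ?_)
      rwa [uIcc_of_le h1.le]
    rw [← integral_deriv_profile hd h h4 hr h1, truncProfile, intervalIntegral.integral_symm,
      intervalIntegral.integral_symm r 1, abs_neg, abs_neg]
    have h0 : 0 ≤ ∫ s in r..1, cutoff n s * deriv ω s :=
      intervalIntegral.integral_nonneg h1.le fun s hs =>
        mul_nonneg (cutoff_nonneg n s) (h4.deriv_nonneg (hsub hs))
    rw [abs_of_nonneg h0]
    refine le_trans (intervalIntegral.integral_mono_on h1.le
      ((continuous_cutoff_mul_deriv hd h n).intervalIntegrable _ _) hI fun s hs => ?_)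
      (le_abs_self _)
    exact mul_le_of_le_one_left (h4.deriv_nonneg (hsub hs)) (cutoff_le_one n s)
  · rw [truncProfile_eq_zero h4 n h1, abs_zero]
    exact abs_nonneg _

/-- The cut-off is applied to ω' and not to ω, so the gradient is merely multiplied by it: no
derivative of the cut-off appears, and ‖∇W‖ dominates. -/
lemma hasFDerivAt_truncKernel (hd : 1 ≤ d) (h : W1 W ω) (n : ℕ) {x : Space d} (hx : x ≠ 0) :
    HasFDerivAt (truncKernel d ω n) (cutoff n ‖x‖ • fderiv ℝ W x) x := by
  have hn : HasFDerivAt (fun y : Space d => ‖y‖) (fderiv ℝ (fun y : Space d => ‖y‖) x) x :=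
    ((contDiffAt_norm ℝ hx).differentiableAt one_ne_zero).hasFDerivAt
  rw [(h.hasFDerivAt hd hx).fderiv, smul_smul]
  exact (hasDerivAt_truncProfile hd h n ‖x‖).comp_hasFDerivAt x hn

/-- The norm is not smooth at the origin, but the truncated profile is constant near 0 because the
cut-off vanishes there. -/
lemma contDiff_truncKernel (hd : 1 ≤ d) (h : W1 W ω) (n : ℕ) :
    ContDiff ℝ 1 (truncKernel d ω n) := by
  rw [contDiff_iff_contDiffAt]
  intro x
  rcases eq_or_ne x 0 with rfl | hx
  · have hev : ∀ᶠ y : Space d in 𝓝 0, (n : ℝ) * ‖y‖ < 1 := by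
      have hc : Continuous fun y : Space d => (n : ℝ) * ‖y‖ := by fun_prop
      exact hc.continuousAt.eventually_lt_const (by simp)
    refine (contDiffAt_const (c := truncProfile ω n 0)).congr_of_eventuallyEq ?_
    filter_upwards [hev] with y hy
    have hsub : ∫ s in (0 : ℝ)..‖y‖, cutoff n s * deriv ω s = 0 := by
      refine (intervalIntegral.integral_congr (g := fun _ => (0 : ℝ)) fun s hs => ?_).trans
        (by simp)
      rw [uIcc_of_le (norm_nonneg y)] at hs
      have : (n : ℝ) * s ≤ 1 := (mul_le_mul_of_nonneg_left hs.2 n.cast_nonneg).trans hy.le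
      simp [cutoff_eq_zero this]
    have hc := continuous_cutoff_mul_deriv hd h n
    have := intervalIntegral.integral_add_adjacent_intervals
      (hc.intervalIntegrable (μ := volume) 1 0) (hc.intervalIntegrable 0 ‖y‖)
    rw [hsub, add_zero] at this
    exact this.symm
  · exact (contDiff_truncProfile hd h n).contDiffAt.comp x (contDiffAt_norm ℝ hx)

lemma hasCompactSupport_truncKernel (h4 : W4 ω) (n : ℕ) :
    HasCompactSupport (truncKernel d ω n) := by
  refine HasCompactSupport.intro (isCompact_closedBall (0 : Space d) 1) fun x hx => ?_
  rw [mem_closedBall_zero_iff, not_le] at hx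
  exact truncProfile_eq_zero h4 n hx.le

lemma abs_truncKernel_le (hd : 1 ≤ d) (h : W1 W ω) (h4 : W4 ω) (n : ℕ) {x : Space d}
    (hx : x ≠ 0) : |truncKernel d ω n x| ≤ |W x| := by
  rw [h.2 x hx]; exact abs_truncProfile_le hd h h4 n (norm_pos_iff.2 hx)

lemma eventually_two_le_mul {r : ℝ} (hr : 0 < r) : ∀ᶠ n : ℕ in atTop, 2 ≤ (n : ℝ) * r :=
  (tendsto_natCast_atTop_atTop.atTop_mul_const hr).eventually_ge_atTop 2

lemma tendsto_truncKernel (hd : 1 ≤ d) (h : W1 W ω) (h4 : W4 ω) {x : Space d} (hx : x ≠ 0) :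
    Tendsto (fun n => truncKernel d ω n x) atTop (𝓝 (W x)) := by
  refine tendsto_const_nhds.congr' ?_
  filter_upwards [eventually_two_le_mul (norm_pos_iff.2 hx)] with n hn
  rw [h.2 x hx]; exact (truncProfile_eq hd h h4 (norm_pos_iff.2 hx) hn).symm

/-- The gradients of the truncated kernels converge in `L¹`. -/
lemma tendsto_integral_fderiv_truncKernel (hd : 1 ≤ d) (h : W1 W ω) (h2 : W2 d ω) (h4 : W4 ω) :
    Tendsto (fun n => ∫ x, ‖fderiv ℝ W x - fderiv ℝ (truncKernel d ω n) x‖) atTop (𝓝 0) := by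
  have hI := integrable_fderiv_kernel hd h h2 h4
  rw [← integral_zero (Space d) ℝ]
  refine tendsto_integral_of_dominated_convergence (fun x => ‖fderiv ℝ W x‖) (fun n => ?_)
    hI.norm (fun n => ?_) ?_
  · exact ((measurable_fderiv ℝ W).sub (measurable_fderiv ℝ _)).norm.aestronglyMeasurable
  · filter_upwards [ae_ne_zero hd] with x hx
    rw [(hasFDerivAt_truncKernel hd h n hx).fderiv, norm_norm]
    nth_rewrite 1 [← one_smul ℝ (fderiv ℝ W x)]
    rw [← sub_smul, norm_smul, Real.norm_of_nonneg (sub_nonneg.2 (cutoff_le_one n _))]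
    exact mul_le_of_le_one_left (norm_nonneg _) (by linarith [cutoff_nonneg n ‖x‖])
  · filter_upwards [ae_ne_zero hd] with x hx
    refine tendsto_const_nhds.congr' ?_
    filter_upwards [eventually_two_le_mul (norm_pos_iff.2 hx)] with n hn
    rw [(hasFDerivAt_truncKernel hd h n hx).fderiv, cutoff_eq_one hn, one_smul, sub_self, norm_zero]

end Kernel

/-! ### The interaction energy as a symmetric bilinear form on L² -/

section Interaction

variable {d : ℕ} {W f g : Space d → ℝ}

/-- For an even integrable kernel the interaction density of two `L²` functions is integrable. -/
lemma integrable_interaction (hW : Integrable W) (heven : ∀ x, W (-x) = W x) (hf : MemLp f 2)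
    (hg : MemLp g 2) :
    Integrable (fun p : Space d × Space d => f p.1 * (W (p.1 - p.2) * g p.2))
      (volume.prod volume) := by
  -- The bound |f(x)g(y)| ≤ f(x)² + g(y)² reduces the claim to the convolution of an L¹ function
  -- with W, once in each variable; evenness matches the two kernels.
  have hg2 := hg.integrable_sq.convolution_integrand (ContinuousLinearMap.mul ℝ ℝ) hW
  have hf2 := (hf.integrable_sq.convolution_integrand (ContinuousLinearMap.mul ℝ ℝ) hW).swap
  have hmeas := hg.1.convolution_integrand (ContinuousLinearMap.mul ℝ ℝ) hW.1 (μ := volume)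
  refine (hf2.norm.add hg2.norm).mono' ?_ (Eventually.of_forall fun p => ?_)
  · refine (hf.1.comp_fst.mul hmeas).congr (Eventually.of_forall fun p => ?_)
    simp [mul_comm]
  · have he : W (p.2 - p.1) = W (p.1 - p.2) := by rw [← neg_sub, heven]
    simp only [Function.comp, Prod.fst_swap, Prod.snd_swap, ContinuousLinearMap.mul_apply',
      Pi.add_apply, he, Real.norm_eq_abs, abs_mul, abs_pow, sq_abs]
    have h0 := abs_nonneg (W (p.1 - p.2))
    have h1 : |f p.1| * |g p.2| ≤ f p.1 ^ 2 + g p.2 ^ 2 := by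
      nlinarith [sq_nonneg (|f p.1| - |g p.2|), sq_abs (f p.1), sq_abs (g p.2),
        sq_nonneg (f p.1), sq_nonneg (g p.2)]
    nlinarith [mul_le_mul_of_nonneg_left h1 h0]

/-- The interaction form, as an integral over the product space. -/
def interaction (W f g : Space d → ℝ) : ℝ :=
  ∫ p : Space d × Space d, f p.1 * (W (p.1 - p.2) * g p.2) ∂(volume.prod volume)

lemma interaction_comm (heven : ∀ x, W (-x) = W x) (f g : Space d → ℝ) :
    interaction W f g = interaction W g f := by
  unfold interaction
  rw [← integral_prod_swap]
  congr 1 with p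
  rw [Prod.fst_swap, Prod.snd_swap, ← neg_sub, heven]
  ring

lemma interaction_eq (hW : Integrable W) (heven : ∀ x, W (-x) = W x) (hf : MemLp f 2)
    (hg : MemLp g 2) :
    (Integrable fun x => f x * conv W g x) ∧ interaction W f g = ∫ x, f x * conv W g x := by
  have h := integrable_interaction hW heven hf hg
  constructor
  · refine h.integral_prod_left.congr (Eventually.of_forall fun x => ?_)
    simp [conv, integral_const_mul]
  · rw [interaction, integral_prod _ h]
    congr 1 with x
    simp [conv, integral_const_mul]

lemma interaction_add_smul (hW : Integrable W) (heven : ∀ x, W (-x) = W x) (hf : MemLp f 2)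
    (hg : MemLp g 2) (t : ℝ) :
    interaction W (fun x => f x + t * g x) (fun x => f x + t * g x) =
      interaction W f f + 2 * t * interaction W g f + t ^ 2 * interaction W g g := by
  have hff := integrable_interaction hW heven hf hf
  have hfg := integrable_interaction hW heven hf hg
  have hgf := integrable_interaction hW heven hg hf
  have hgg := integrable_interaction hW heven hg hg
  have hc := interaction_comm heven f g
  have : interaction W (fun x => f x + t * g x) (fun x => f x + t * g x) =
      interaction W f f + t * interaction W f g + t * interaction W g f
        + t ^ 2 * interaction W g g := by
    unfold interaction
    have h1 := (hff.add (hfg.const_mul t)).add (hgf.const_mul t)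
    rw [← integral_const_mul, ← integral_const_mul, ← integral_const_mul,
      ← integral_add' hff (hfg.const_mul t),
      ← integral_add' (hff.add (hfg.const_mul t)) (hgf.const_mul t),
      ← integral_add' h1 (hgg.const_mul _)]
    congr 1 with p
    simp only [Pi.add_apply]
    ring
  rw [this, hc]; ring

end Interaction

/-! ### Differentiating the internal energy -/

section Power

variable {α : Type*} [MeasurableSpace α] {μ : Measure α} {m : ℝ} {f g : α → ℝ}

lemma MemLp.integrable_abs_rpow (hm : 0 < m) (hf : MemLp f (ENNReal.ofReal m) μ) :
    Integrable (fun x => |f x| ^ m) μ := by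
  have := hf.integrable_norm_rpow (by simpa using hm) ENNReal.ofReal_ne_top
  simpa [ENNReal.toReal_ofReal hm.le] using this

/-- Gateaux derivative of `f ↦ ∫ f^m` on `L^m`. -/
lemma hasDerivAt_integral_rpow (hm : 1 < m) (hf : MemLp f (ENNReal.ofReal m) μ)
    (hg : MemLp g (ENNReal.ofReal m) μ) :
    Integrable (fun x => m * f x ^ (m - 1) * g x) μ ∧
      HasDerivAt (fun t : ℝ => ∫ x, (f x + t * g x) ^ m ∂μ)
        (∫ x, m * f x ^ (m - 1) * g x ∂μ) 0 := by
  have hm0 : 0 < m := zero_lt_one.trans hm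
  have hmeas : ∀ (t p : ℝ), AEStronglyMeasurable (fun x => (f x + t * g x) ^ p) μ := fun t p =>
    ((hf.1.aemeasurable.add (hg.1.aemeasurable.const_mul t)).pow_const p).aestronglyMeasurable
  have hb : Integrable (fun x => m * (|f x| + |g x|) ^ m) μ := by
    have := (MemLp.integrable_abs_rpow hm0 (hf.norm.add hg.norm)).const_mul m
    refine this.congr (Eventually.of_forall fun x => ?_)
    simp only [Pi.add_apply, Real.norm_eq_abs]
    rw [abs_of_nonneg (add_nonneg (abs_nonneg _) (abs_nonneg _))]
  -- The neighbourhood of t = 0 is two-sided, so f + tg may be negative. `Real.rpow` remains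
  -- differentiable there because m ≥ 1, with the same formula, and is bounded by the power of the
  -- absolute value.
  have key := hasDerivAt_integral_of_dominated_loc_of_deriv_le (μ := μ)
    (F := fun (t : ℝ) x => (f x + t * g x) ^ m)
    (F' := fun t x => m * (f x + t * g x) ^ (m - 1) * g x) (x₀ := (0 : ℝ))
    (s := Metric.ball 0 1) (bound := fun x => m * (|f x| + |g x|) ^ m)
    (Metric.ball_mem_nhds _ one_pos) (Eventually.of_forall fun t => hmeas t m) ?_
    (((hmeas 0 (m - 1)).const_mul m).mul hg.1) (Eventually.of_forall fun x t ht => ?_) hb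
    (Eventually.of_forall fun x t _ => ?_)
  · simpa using key
  · refine (MemLp.integrable_abs_rpow hm0 hf).mono' (hmeas 0 m) (Eventually.of_forall fun x => ?_)
    simpa using Real.abs_rpow_le_abs_rpow (f x) m
  · rw [mem_ball_zero_iff, Real.norm_eq_abs] at ht
    have hs : |f x + t * g x| ≤ |f x| + |g x| := by
      refine (abs_add_le _ _).trans (add_le_add_right ?_ _)
      rw [abs_mul]
      exact mul_le_of_le_one_left (abs_nonneg _) ht.le
    have h0 : 0 ≤ |f x| + |g x| := add_nonneg (abs_nonneg _) (abs_nonneg _)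
    rw [Real.norm_eq_abs, abs_mul, abs_mul, abs_of_pos hm0, mul_assoc]
    refine mul_le_mul_of_nonneg_left ?_ hm0.le
    calc |(f x + t * g x) ^ (m - 1)| * |g x|
        ≤ (|f x| + |g x|) ^ (m - 1) * (|f x| + |g x|) := by
          refine mul_le_mul ((Real.abs_rpow_le_abs_rpow _ _).trans
            (Real.rpow_le_rpow (abs_nonneg _) hs (by linarith))) ?_ (abs_nonneg _)
            (Real.rpow_nonneg h0 _)
          linarith [abs_nonneg (f x)]
      _ = (|f x| + |g x|) ^ m := by
          nth_rewrite 2 [← Real.rpow_one (|f x| + |g x|)]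
          rw [← Real.rpow_add_of_nonneg h0 (by linarith) zero_le_one, sub_add_cancel]
  · have h1 : HasDerivAt (fun t : ℝ => f x + t * g x) (g x) t := by
      simpa using ((hasDerivAt_id t).mul_const (g x)).const_add (f x)
    have := h1.rpow_const (p := m) (Or.inr hm.le)
    convert! this using 1
    ring

end Power

/-! ### Euler–Lagrange conditions -/

section Minimizer

variable {d : ℕ} {ε m M : ℝ} {W ρ σ : Space d → ℝ}

/-- Because m > 2, s² ≤ s + s^m for s ≥ 0. Square integrability is what makes the interaction energy
finite when W is only in L¹. -/
lemma memLp_two_of_mem_massClass (hm : 2 < m) (h : σ ∈ massClass d m M) : MemLp σ 2 := by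
  obtain ⟨h0, h1, h2, -⟩ := h
  rw [memLp_two_iff_integrable_sq h1.1]
  refine (h1.norm.add (MemLp.integrable_abs_rpow (by linarith) h2)).mono' (h1.1.pow 2)
    (Eventually.of_forall fun x => ?_)
  simp only [Pi.add_apply, Real.norm_eq_abs, abs_pow]
  have ha := abs_nonneg (σ x)
  rcases le_total (|σ x|) 1 with hx | hx
  · have := Real.rpow_nonneg ha m
    nlinarith
  · have := Real.rpow_le_rpow_of_exponent_le hx hm.le
    rw [Real.rpow_two] at this
    linarith

lemma segment_mem_massClass (hρ : ρ ∈ massClass d m M) (hσ : σ ∈ massClass d m M) {t : ℝ}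
    (h0 : 0 ≤ t) (h1 : t ≤ 1) : (fun x => ρ x + t * (σ x - ρ x)) ∈ massClass d m M := by
  obtain ⟨hρ0, hρ1, hρm, hρM⟩ := hρ
  obtain ⟨hσ0, hσ1, hσm, hσM⟩ := hσ
  have hpos : 0 ≤ᵐ[volume] fun x => ρ x + t * (σ x - ρ x) := by
    filter_upwards [hρ0, hσ0] with x hx hy
    simp only [Pi.zero_apply] at hx hy ⊢
    nlinarith [mul_nonneg (sub_nonneg.2 h1) hx, mul_nonneg h0 hy]
  have hnorm : ∀ f : Space d → ℝ, 0 ≤ᵐ[volume] f → ∫ x, ‖f x‖ = ∫ x, f x := fun f hf =>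
    integral_congr_ae (hf.mono fun x hx => Real.norm_of_nonneg hx)
  refine ⟨hpos, hρ1.add ((hσ1.sub hρ1).const_mul t), hρm.add ((hσm.sub hρm).const_mul t), ?_⟩
  rw [hnorm _ hρ0] at hρM
  rw [hnorm _ hσ0] at hσM
  have hτ : Integrable fun x => σ x - ρ x := hσ1.sub hρ1
  rw [hnorm _ hpos, integral_add hρ1 (hτ.const_mul t), integral_const_mul, integral_sub hσ1 hρ1,
    hρM, hσM]
  ring

/-- The first variation of the energy at `ρ`. -/
def firstVariation (ε m : ℝ) (W ρ : Space d → ℝ) (x : Space d) : ℝ :=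
  ε * m / (m - 1) * ρ x ^ (m - 1) + conv W ρ x

lemma integrable_mul_firstVariation (hm : 2 < m) (hW : Integrable W)
    (heven : ∀ x, W (-x) = W x) (hρ : ρ ∈ massClass d m M) (hσ : σ ∈ massClass d m M) :
    Integrable fun x => σ x * firstVariation ε m W ρ x := by
  have h1 := (hasDerivAt_integral_rpow (by linarith) hρ.2.2.1 hσ.2.2.1).1
  have h2 := (interaction_eq hW heven (memLp_two_of_mem_massClass hm hσ)
    (memLp_two_of_mem_massClass hm hρ)).1
  refine ((h1.const_mul (ε / (m - 1))).add h2).congr (Eventually.of_forall fun x => ?_)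
  simp only [Pi.add_apply, firstVariation]
  ring

/-- The variational inequality satisfied by a minimizer. -/
lemma integral_firstVariation_le (hm : 2 < m) (hW : Integrable W)
    (heven : ∀ x, W (-x) = W x) (hρ : IsGlobalMinimizer ε m M W ρ) (hσ : σ ∈ massClass d m M) :
    ∫ x, ρ x * firstVariation ε m W ρ x ≤ ∫ x, σ x * firstVariation ε m W ρ x := by
  have hρ2 := memLp_two_of_mem_massClass hm hρ.1
  have hσ2 := memLp_two_of_mem_massClass hm hσ
  have hτ2 : MemLp (fun x => σ x - ρ x) 2 := hσ2.sub hρ2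
  have hτm : MemLp (fun x => σ x - ρ x) (ENNReal.ofReal m) := hσ.2.2.1.sub hρ.1.2.2.1
  obtain ⟨hPi, hP⟩ := hasDerivAt_integral_rpow (by linarith : 1 < m) hρ.1.2.2.1 hτm
  set τ : Space d → ℝ := fun x => σ x - ρ x with hτ
  set B0 := interaction W ρ ρ
  set B1 := interaction W τ ρ with hB1
  set B2 := interaction W τ τ
  -- ψ is defined for all t and has a two-sided derivative at 0, but it is the energy of an
  -- admissible competitor only for t in [0, 1]; hence only right slopes have a known sign.
  let ψ : ℝ → ℝ := fun t => ε / (m - 1) * (∫ x, (ρ x + t * τ x) ^ m) +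
    1 / 2 * (B0 + 2 * t * B1 + t ^ 2 * B2)
  have hψ : ∀ t, 0 ≤ t → t ≤ 1 → ψ t = energy ε m W fun x => ρ x + t * τ x := by
    intro t h0 h1
    have h2 := memLp_two_of_mem_massClass hm (segment_mem_massClass hρ.1 hσ h0 h1)
    rw [energy, ← (interaction_eq hW heven h2 h2).2, interaction_add_smul hW heven hρ2 hτ2 t]
  have hder : HasDerivAt ψ (ε / (m - 1) * (∫ x, m * ρ x ^ (m - 1) * τ x) + B1) 0 := by
    have hq : HasDerivAt (fun t : ℝ => B0 + 2 * t * B1 + t ^ 2 * B2) (2 * B1) 0 := by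
      have h1 : HasDerivAt (fun t : ℝ => 2 * t * B1) (2 * B1) 0 := by
        simpa using ((hasDerivAt_id (0 : ℝ)).const_mul 2).mul_const B1
      have h2 : HasDerivAt (fun t : ℝ => t ^ 2 * B2) 0 0 := by
        simpa using ((hasDerivAt_id (0 : ℝ)).pow 2).mul_const B2
      simpa using (h1.const_add B0).fun_add h2
    have := (hP.const_mul (ε / (m - 1))).add (hq.const_mul (1 / 2))
    convert! this using 1
    ring
  have hnn : 0 ≤ ε / (m - 1) * (∫ x, m * ρ x ^ (m - 1) * τ x) + B1 := by
    refine ge_of_tendsto hder.tendsto_slope_zero_right ?_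
    filter_upwards [Ioo_mem_nhdsGT (zero_lt_one : (0 : ℝ) < 1)] with t ht
    have hmin := hρ.2 _ (segment_mem_massClass hρ.1 hσ ht.1.le ht.2.le)
    have h0 : ψ 0 = energy ε m W ρ := by simpa using hψ 0 le_rfl zero_le_one
    rw [zero_add, smul_eq_mul, hψ t ht.1.le ht.2.le, h0]
    exact mul_nonneg (inv_nonneg.2 ht.1.le) (sub_nonneg.2 hmin)
  obtain ⟨hBi, hBe⟩ := interaction_eq hW heven hτ2 hρ2
  rw [hB1, hBe, ← integral_const_mul, ← integral_add (hPi.const_mul _) hBi] at hnn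
  rw [← sub_nonneg, ← integral_sub (integrable_mul_firstVariation hm hW heven hρ.1 hσ)
    (integrable_mul_firstVariation hm hW heven hρ.1 hρ.1)]
  refine hnn.trans_eq (integral_congr_ae (Eventually.of_forall fun x => ?_))
  simp only [firstVariation, hτ]
  ring

lemma indicator_mem_massClass (hM : 0 < M) {B : Set (Space d)}
    (hB : MeasurableSet B) (h0 : volume B ≠ 0) (htop : volume B ≠ ∞) :
    B.indicator (fun _ => M / volume.real B) ∈ massClass d m M := by
  have hv : 0 < volume.real B := ENNReal.toReal_pos h0 htop
  have hc : 0 ≤ M / volume.real B := (div_pos hM hv).le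
  refine ⟨Eventually.of_forall fun x => indicator_nonneg (fun _ _ => hc) x,
    (integrable_indicator_iff hB).2 (integrableOn_const htop), memLp_indicator_const _ hB _ (Or.inr htop), ?_⟩
  have : (fun x => ‖B.indicator (fun _ => M / volume.real B) x‖) =
      B.indicator fun _ => M / volume.real B := by
    ext x; exact Real.norm_of_nonneg (indicator_nonneg (fun _ _ => hc) x)
  rw [this, integral_indicator_const _ hB, smul_eq_mul]
  field_simp

/-- Euler–Lagrange: the first variation is bounded below by a constant, which it equals on the
positivity set of the minimizer. -/
lemma exists_firstVariation_eq (hm : 2 < m) (hM : 0 < M) (hW : Integrable W)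
    (heven : ∀ x, W (-x) = W x) (hρ : IsGlobalMinimizer ε m M W ρ) :
    ∃ Λ : ℝ, (∀ᵐ x, Λ ≤ firstVariation ε m W ρ x) ∧
      ∀ᵐ x, ρ x ≠ 0 → firstVariation ε m W ρ x = Λ := by
  set V := firstVariation ε m W ρ with hV
  set I := ∫ x, ρ x * V x with hI
  have hle : ∀ σ ∈ massClass d m M, I ≤ ∫ x, σ x * V x := fun σ hσ =>
    integral_firstVariation_le hm hW heven hρ hσ
  have hint : ∀ σ ∈ massClass d m M, Integrable fun x => σ x * V x := fun σ hσ =>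
    integrable_mul_firstVariation hm hW heven hρ.1 hσ
  -- Competitors spread uniformly over B show that the mean of V over every such B is at least I /
  -- M, so V ≥ I / M almost everywhere.
  have hset : ∀ B : Set (Space d), MeasurableSet B → volume B ≠ 0 → volume B ≠ ∞ →
      IntegrableOn V B ∧ I / M * volume.real B ≤ ∫ x in B, V x := by
    intro B hB h0 htop
    have hσ := indicator_mem_massClass (d := d) (m := m) hM hB h0 htop
    have hv : 0 < volume.real B := ENNReal.toReal_pos h0 htop
    have hc : 0 < M / volume.real B := div_pos hM hv
    have heq : (fun x => B.indicator (fun _ => M / volume.real B) x * V x) =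
        B.indicator fun x => M / volume.real B * V x := by
      ext x; by_cases hx : x ∈ B <;> simp [hx]
    have h1 := hint _ hσ
    have h2 := hle _ hσ
    rw [heq] at h1 h2
    rw [integrable_indicator_iff hB] at h1
    rw [integral_indicator hB, integral_const_mul] at h2
    refine ⟨?_, ?_⟩
    · have := h1.const_mul (M / volume.real B)⁻¹
      refine this.congr (Eventually.of_forall fun x => ?_)
      simp only
      rw [inv_mul_cancel_left₀ hc.ne']
    · rw [div_mul_eq_mul_div, le_div_iff₀ hv] at h2
      rw [div_mul_eq_mul_div, div_le_iff₀ hM]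
      linarith
  have hintB : ∀ B : Set (Space d), MeasurableSet B → volume B < ∞ → IntegrableOn V B := by
    intro B hB htop
    by_cases h0 : volume B = 0
    · exact IntegrableOn.of_measure_zero h0
    · exact (hset B hB h0 htop.ne).1
  have hlow : 0 ≤ᵐ[volume] fun x => V x - I / M := by
    refine ae_nonneg_of_forall_setIntegral_nonneg_of_sigmaFinite
      (fun B hB htop => (hintB B hB htop).sub (integrableOn_const htop.ne)) fun B hB htop => ?_
    by_cases h0 : volume B = 0
    · rw [setIntegral_measure_zero _ h0]
    · rw [integral_sub (hintB B hB htop) (integrableOn_const htop.ne), setIntegral_const, smul_eq_mul]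
      linarith [(hset B hB h0 htop.ne).2]
  refine ⟨I / M, hlow.mono fun x hx => by simpa using hx, ?_⟩
  obtain ⟨hρ0, hρ1, -, hρM⟩ := hρ.1
  rw [integral_congr_ae (hρ0.mono fun x hx => Real.norm_of_nonneg hx)] at hρM
  -- ρ(V - I/M) is nonnegative and its integral is I - (I/M)M = 0, so it vanishes almost everywhere.
  have hprod : 0 ≤ᵐ[volume] fun x => ρ x * V x - I / M * ρ x := by
    filter_upwards [hρ0, hlow] with x hx hy
    simp only [Pi.zero_apply] at hx hy ⊢
    nlinarith [mul_nonneg hx hy]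
  have hzero : ∫ x, (ρ x * V x - I / M * ρ x) = 0 := by
    rw [integral_sub (hint ρ hρ.1) (hρ1.const_mul _), integral_const_mul, hρM,
      div_mul_cancel₀ _ hM.ne', sub_self]
  rw [integral_eq_zero_iff_of_nonneg_ae hprod ((hint ρ hρ.1).sub (hρ1.const_mul _))] at hzero
  filter_upwards [hzero] with x hx hne
  have : ρ x * (V x - I / M) = 0 := by
    have : ρ x * V x - I / M * ρ x = 0 := hx
    linarith
  exact sub_eq_zero.1 ((mul_eq_zero.1 this).resolve_left hne)

/-- The Euler–Lagrange equation in closed form; the multiplier is nonpositive. -/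
lemma exists_rpow_eq_max (hd : 1 ≤ d) (hε : 0 < ε) (hm : 2 < m) (hM : 0 < M) (hW : Integrable W)
    (heven : ∀ x, W (-x) = W x) (hneg : ∀ x, x ≠ 0 → W x ≤ 0)
    (hρ : IsGlobalMinimizer ε m M W ρ) :
    ∃ Λ ≤ (0 : ℝ), ∀ᵐ x, ρ x ^ (m - 1) = max ((Λ - conv W ρ x) / (ε * m / (m - 1))) 0 := by
  obtain ⟨Λ, hΛ, hΛ'⟩ := exists_firstVariation_eq hm hM hW heven hρ
  have hκ : 0 < ε * m / (m - 1) := div_pos (mul_pos hε (by linarith)) (by linarith)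
  set κ := ε * m / (m - 1) with hκe
  obtain ⟨hρ0, hρ1, -, hρM⟩ := hρ.1
  have : Nonempty (Fin d) := ⟨⟨0, hd⟩⟩
  refine ⟨Λ, ?_, ?_⟩
  -- If Λ > 0, then W*ρ ≤ 0 forces ρ ≥ (Λ/κ)^(1/(m-1)) > 0 almost everywhere, and a positive
  -- constant would be integrable on ℝ^d.
  · by_contra! hpos
    have hconv : ∀ x, conv W ρ x ≤ 0 := by
      intro x
      refine integral_nonpos_of_ae ?_
      filter_upwards [hρ0, Measure.ae_ne volume x] with y hy hxy
      exact mul_nonpos_of_nonpos_of_nonneg (hneg _ (sub_ne_zero.2 hxy.symm)) hy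
    have hδ : 0 < (Λ / κ) ^ (m - 1)⁻¹ := Real.rpow_pos_of_pos (div_pos hpos hκ) _
    have hlow : ∀ᵐ x, (Λ / κ) ^ (m - 1)⁻¹ ≤ ρ x := by
      filter_upwards [hΛ, hρ0] with x hx h0
      have h0' : 0 ≤ ρ x := h0
      have h1 : Λ / κ ≤ ρ x ^ (m - 1) := by
        rw [div_le_iff₀ hκ]
        have := hconv x
        rw [firstVariation, ← hκe] at hx
        linarith
      calc (Λ / κ) ^ (m - 1)⁻¹ ≤ (ρ x ^ (m - 1)) ^ (m - 1)⁻¹ :=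
            Real.rpow_le_rpow (div_pos hpos hκ).le h1 (inv_nonneg.2 (by linarith))
        _ = ρ x := Real.rpow_rpow_inv h0' (by linarith)
    have hi : Integrable (fun _ : Space d => (Λ / κ) ^ (m - 1)⁻¹) := by
      refine hρ1.mono' aestronglyMeasurable_const ?_
      filter_upwards [hlow] with x hx
      rwa [Real.norm_of_nonneg hδ.le]
    have : NoncompactSpace (Space d) := NormedSpace.noncompactSpace ℝ _
    have hfin := (integrable_const_iff_isFiniteMeasure hδ.ne').1 hi
    have := measure_lt_top (volume : Measure (Space d)) univ
    rw [measure_univ_of_isAddLeftInvariant] at this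
    exact lt_irrefl _ this
  · filter_upwards [hΛ, hΛ', hρ0] with x h1 h2 h0
    have h0' : 0 ≤ ρ x := h0
    rw [firstVariation, ← hκe] at h1 h2
    rcases h0'.eq_or_lt with hz | hz
    · rw [← hz, Real.zero_rpow (by linarith), mul_zero] at h1
      rw [← hz, Real.zero_rpow (by linarith), max_eq_right]
      exact div_nonpos_of_nonpos_of_nonneg (by linarith) hκ.le
    · have h3 := h2 hz.ne'
      have : ρ x ^ (m - 1) = (Λ - conv W ρ x) / κ := by
        rw [eq_div_iff hκ.ne']; linarith
      rw [← this, max_eq_left (Real.rpow_nonneg h0' _)]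

end Minimizer

/-! ### From L^q to L^∞ by iterating Young's inequality -/

section Bootstrap

variable {d : ℕ} {w r : Space d → ℝ≥0∞}

/-- Young's inequality `‖w * r‖_q ≤ ‖w‖_1 ‖r‖_q` for nonnegative functions. -/
lemma lintegral_conv_rpow_le (hw : Measurable w) (hr : AEMeasurable r) {q : ℝ} (hq : 1 ≤ q) :
    ∫⁻ x, (∫⁻ y, w (x - y) * r y) ^ q ≤ (∫⁻ x, w x) ^ q * ∫⁻ x, r x ^ q := by
  have hq0 : 0 < q := zero_lt_one.trans_le hq
  have hpt : ∀ x, (∫⁻ y, w (x - y) * r y) ^ q ≤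
      (∫⁻ x, w x) ^ (q - 1) * ∫⁻ y, w (x - y) * r y ^ q := by
    intro x
    have hwx : Measurable fun y => w (x - y) := hw.comp (measurable_const.sub measurable_id)
    -- Hölder with the splitting w r = w^(1-1/q) (w r^q)^(1/q), so that only the mass of w enters
    -- the constant.
    have h := ENNReal.lintegral_mul_norm_pow_le (μ := volume) (f := fun y => w (x - y))
      (g := fun y => w (x - y) * r y ^ q) hwx.aemeasurable
      (hwx.aemeasurable.mul (hr.pow_const q)) (p := 1 - 1 / q) (q := 1 / q)
      (by rw [sub_nonneg, div_le_one hq0]; exact hq) (by positivity) (by ring)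
    have heq : ∀ y, w (x - y) ^ (1 - 1 / q) * (w (x - y) * r y ^ q) ^ (1 / q) =
        w (x - y) * r y := by
      intro y
      rw [ENNReal.mul_rpow_of_nonneg _ _ (by positivity), ← ENNReal.rpow_mul, ← mul_assoc,
        ← ENNReal.rpow_add_of_nonneg _ _ (by rw [sub_nonneg, div_le_one hq0]; exact hq)
          (by positivity), mul_one_div_cancel hq0.ne']
      simp
    simp only [heq] at h
    rw [lintegral_sub_left_eq_self w x] at h
    calc (∫⁻ y, w (x - y) * r y) ^ q
        ≤ ((∫⁻ x, w x) ^ (1 - 1 / q) * (∫⁻ y, w (x - y) * r y ^ q) ^ (1 / q)) ^ q :=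
          ENNReal.rpow_le_rpow h hq0.le
      _ = _ := by
          rw [ENNReal.mul_rpow_of_nonneg _ _ hq0.le, ← ENNReal.rpow_mul, ← ENNReal.rpow_mul,
            one_div_mul_cancel hq0.ne', ENNReal.rpow_one, sub_mul, one_div_mul_cancel hq0.ne',
            one_mul]
  refine (lintegral_mono hpt).trans ?_
  have hmeas : AEMeasurable (Function.uncurry fun x y : Space d => w (x - y) * r y ^ q)
      (volume.prod volume) :=
    (hw.comp (measurable_fst.sub measurable_snd)).aemeasurable.mul
      ((hr.comp_snd).pow_const q)
  have hmeas' : AEMeasurable fun x => ∫⁻ y, w (x - y) * r y ^ q := hmeas.lintegral_prod_right'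
  rw [lintegral_const_mul'' _ hmeas', lintegral_lintegral_swap hmeas]
  have : ∀ y, ∫⁻ x, w (x - y) * r y ^ q = (∫⁻ x, w x) * r y ^ q := by
    intro y
    have hwy : Measurable fun x => w (x - y) := hw.comp (measurable_id.sub measurable_const)
    rw [lintegral_mul_const _ hwy,
      lintegral_sub_right_eq_self w y]
  simp only [this]
  rw [lintegral_const_mul'' _ (hr.pow_const q), ← mul_assoc]
  refine mul_le_mul_left (le_of_eq ?_) _
  nth_rewrite 2 [← ENNReal.rpow_one (∫⁻ x, w x)]
  rw [← ENNReal.rpow_add_of_nonneg _ _ (by linarith) zero_le_one, sub_add_cancel]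

/-- If `r^a ≤ w * r` with `a > 1`, `w ∈ L¹` and `r ∈ L^q`, then `r` is essentially bounded. -/
lemma exists_ae_le_of_rpow_le_conv (hw : Measurable w) (hw1 : ∫⁻ x, w x ≠ ∞)
    (hr : AEMeasurable r) {a q : ℝ} (ha : 1 < a) (hq : 1 ≤ q) (hrq : ∫⁻ x, r x ^ q ≠ ∞)
    (hle : ∀ᵐ x, r x ^ a ≤ ∫⁻ y, w (x - y) * r y) : ∃ A : ℝ≥0∞, A ≠ ∞ ∧ ∀ᵐ x, r x ≤ A := by
  -- L = K^(1/(a-1)) solves K L = L^a, so the bound L^(e k) reproduces itself when the exponent is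
  -- multiplied by a. The maximum with 1 gives L ≥ 1, needed to start the induction, and keeps L
  -- nonzero for cancellation.
  set K : ℝ≥0∞ := max (∫⁻ x, w x) 1 with hK
  have hKtop : K ≠ ∞ := by simp [hK, hw1]
  have hK1 : 1 ≤ K := le_max_right _ _
  have hK0 : K ≠ 0 := (zero_lt_one.trans_le hK1).ne'
  have ha1 : 0 < a - 1 := sub_pos.2 ha
  set L : ℝ≥0∞ := K ^ (a - 1)⁻¹ with hL
  have hLtop : L ≠ ∞ := ENNReal.rpow_ne_top_of_nonneg (inv_nonneg.2 ha1.le) hKtop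
  have hL0 : L ≠ 0 := (ENNReal.rpow_pos (zero_lt_one.trans_le hK1) hKtop).ne'
  have hKL : K = L ^ (a - 1) := by rw [hL, ENNReal.rpow_inv_rpow ha1.ne']
  set e : ℕ → ℝ := fun k => q * a ^ k with he
  have he1 : ∀ k, 1 ≤ e k := fun k => one_le_mul_of_one_le_of_one_le hq (one_le_pow₀ ha.le)
  have hstep : ∀ k, ∫⁻ x, r x ^ e k ≤ L ^ e k * ∫⁻ x, r x ^ q := by
    intro k
    induction k with
    | zero =>
      simp only [he, pow_zero, mul_one]
      refine le_mul_of_one_le_left zero_le ?_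
      exact ENNReal.one_le_rpow (ENNReal.one_le_rpow hK1 (inv_pos.2 ha1)) (by linarith)
    | succ k ih =>
      have hek : e (k + 1) = a * e k := by simp only [he, pow_succ]; ring
      have hek0 : 0 ≤ e k := by linarith [he1 k]
      calc ∫⁻ x, r x ^ e (k + 1) ≤ ∫⁻ x, (∫⁻ y, w (x - y) * r y) ^ e k := by
            refine lintegral_mono_ae (hle.mono fun x hx => ?_)
            rw [hek, ENNReal.rpow_mul]
            exact ENNReal.rpow_le_rpow hx hek0
        _ ≤ (∫⁻ x, w x) ^ e k * ∫⁻ x, r x ^ e k := lintegral_conv_rpow_le hw hr (he1 k)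
        _ ≤ K ^ e k * (L ^ e k * ∫⁻ x, r x ^ q) :=
            mul_le_mul' (ENNReal.rpow_le_rpow (le_max_left _ _) hek0) ih
        _ = L ^ e (k + 1) * ∫⁻ x, r x ^ q := by
            rw [hKL, ← ENNReal.rpow_mul, ← mul_assoc, ← ENNReal.rpow_add _ _ hL0 hLtop, hek]
            congr 2
            ring
  refine ⟨2 * L, ENNReal.mul_ne_top ENNReal.ofNat_ne_top hLtop, ?_⟩
  set s := volume {x | 2 * L ≤ r x} with hs
  -- Chebyshev at level 2L: the L^(e k) cancels and leaves 2^(e k), which is unbounded, while the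
  -- right side is fixed. Any factor above 1 would do in place of 2.
  have hcheb : ∀ k, (2 : ℝ≥0∞) ^ e k * s ≤ ∫⁻ x, r x ^ q := by
    intro k
    have hek0 : 0 ≤ e k := by linarith [he1 k]
    have h1 : (2 * L) ^ e k * s ≤ ∫⁻ x, r x ^ e k := by
      refine le_trans ?_ (mul_meas_ge_le_lintegral₀ (hr.pow_const (e k)) ((2 * L) ^ e k))
      exact mul_le_mul_right (measure_mono fun x hx => ENNReal.rpow_le_rpow hx hek0) _
    have h2 := h1.trans (hstep k)
    rw [ENNReal.mul_rpow_of_nonneg _ _ hek0, mul_comm (2 ^ e k) (L ^ e k), mul_assoc] at h2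
    have hLe0 : L ^ e k ≠ 0 := (ENNReal.rpow_pos (pos_iff_ne_zero.2 hL0) hLtop).ne'
    have hLet : L ^ e k ≠ ∞ := ENNReal.rpow_ne_top_of_nonneg hek0 hLtop
    exact (ENNReal.mul_le_mul_iff_right hLe0 hLet).1 h2
  have hs0 : s = 0 := by
    by_contra hne
    have htend : Tendsto (fun k => (2 : ℝ) ^ e k) atTop atTop := by
      refine (tendsto_rpow_atTop_of_base_gt_one 2 one_lt_two).comp ?_
      exact (tendsto_pow_atTop_atTop_of_one_lt ha).const_mul_atTop (by linarith)
    obtain ⟨k, hk⟩ := (htend.eventually_gt_atTop ((∫⁻ x, r x ^ q) / s).toReal).exists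
    have hdiv : (∫⁻ x, r x ^ q) / s ≠ ∞ := ENNReal.div_ne_top hrq hne
    have h1 : (2 : ℝ≥0∞) ^ e k ≤ (∫⁻ x, r x ^ q) / s := by
      rw [ENNReal.le_div_iff_mul_le (Or.inl hne) (Or.inr hrq)]
      exact hcheb k
    have h2 := ENNReal.toReal_mono hdiv h1
    rw [← ENNReal.toReal_rpow, ENNReal.toReal_ofNat] at h2
    exact absurd hk (not_lt.2 h2)
  have : ∀ᵐ x, ¬ 2 * L ≤ r x := by
    rw [ae_iff]; simpa using hs0
  exact this.mono fun x hx => (not_le.1 hx).le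

end Bootstrap

lemma W1.measurable {d : ℕ} {W : Space d → ℝ} {ω : ℝ → ℝ} (h : W1 W ω) : Measurable W :=
  measurable_of_continuousOn_compl_singleton 0 h.1.continuousOn

/-- A density with `ρ^a ≤ c |W * ρ|`, `a > 1` and `W ∈ L¹`, is essentially bounded. -/
lemma exists_ae_norm_le {d : ℕ} {W ρ : Space d → ℝ} {a m c : ℝ} (hWm : Measurable W)
    (hW : Integrable W) (ha : 1 < a) (hm : 1 ≤ m) (hc : 0 ≤ c) (hρ0 : 0 ≤ᵐ[volume] ρ)
    (hρm : MemLp ρ (ENNReal.ofReal m)) (hle : ∀ᵐ x, ρ x ^ a ≤ c * |conv W ρ x|) :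
    ∃ A : ℝ, 0 ≤ A ∧ ∀ᵐ x, ‖ρ x‖ ≤ A := by
  have hm0 : 0 < m := by linarith
  have hcW : Measurable fun x => ENNReal.ofReal c * ‖W x‖ₑ := hWm.enorm.const_mul _
  have hw1 : ∫⁻ x, ENNReal.ofReal c * ‖W x‖ₑ ≠ ∞ := by
    rw [lintegral_const_mul _ hWm.enorm]
    exact ENNReal.mul_ne_top ENNReal.ofReal_ne_top hW.2.ne
  suffices h : ∃ A : ℝ≥0∞, A ≠ ∞ ∧ ∀ᵐ x, ‖ρ x‖ₑ ≤ A by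
    obtain ⟨A, hA, hA'⟩ := h
    refine ⟨A.toReal, ENNReal.toReal_nonneg, hA'.mono fun x hx => ?_⟩
    rw [← toReal_enorm]
    exact ENNReal.toReal_mono hA hx
  refine exists_ae_le_of_rpow_le_conv hcW hw1 hρm.1.enorm ha hm ?_ ?_
  · have := lintegral_rpow_enorm_lt_top_of_eLpNorm_lt_top (by simpa using hm0)
      ENNReal.ofReal_ne_top hρm.2
    rw [ENNReal.toReal_ofReal hm0.le] at this
    exact this.ne
  · filter_upwards [hle, hρ0] with x hx h0
    have h0' : 0 ≤ ρ x := h0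
    calc ‖ρ x‖ₑ ^ a = ENNReal.ofReal (ρ x ^ a) := by
          rw [Real.enorm_of_nonneg h0', ENNReal.ofReal_rpow_of_nonneg h0' (by linarith)]
      _ ≤ ENNReal.ofReal (c * |conv W ρ x|) := ENNReal.ofReal_le_ofReal hx
      _ = ENNReal.ofReal c * ‖conv W ρ x‖ₑ := by
          rw [ENNReal.ofReal_mul hc, Real.enorm_eq_ofReal_abs]
      _ ≤ ENNReal.ofReal c * ∫⁻ y, ‖W (x - y) * ρ y‖ₑ :=
          mul_le_mul_right (enorm_integral_le_lintegral_enorm _) _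
      _ = ∫⁻ y, ENNReal.ofReal c * ‖W (x - y)‖ₑ * ‖ρ y‖ₑ := by
          rw [← lintegral_const_mul' _ _ ENNReal.ofReal_ne_top]
          simp only [enorm_mul, mul_assoc]

/-! ### Differentiability of the potential of a bounded density -/

section Regularity

variable {d : ℕ} {W ρ : Space d → ℝ} {ω : ℝ → ℝ} {A : ℝ}

/-- A bounded function times a reflected and translated integrable function is integrable, and
its integral is bounded uniformly in the translation. -/
lemma integrable_smul_comp_sub {F : Type*} [NormedAddCommGroup F] [NormedSpace ℝ F]
    {k : Space d → F} (hk : Integrable k) (hρ : AEStronglyMeasurable ρ) (hA : ∀ᵐ x, ‖ρ x‖ ≤ A)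
    (x : Space d) :
    (Integrable fun y => ρ y • k (x - y)) ∧
      ‖∫ y, ρ y • k (x - y)‖ ≤ A * ∫ y, ‖k y‖ := by
  have hkx : Integrable fun y => k (x - y) := hk.comp_sub_left x
  refine ⟨hkx.bdd_smul A hρ hA, ?_⟩
  calc ‖∫ y, ρ y • k (x - y)‖ ≤ ∫ y, A * ‖k (x - y)‖ := by
        refine norm_integral_le_of_norm_le (hkx.norm.const_mul A) (hA.mono fun y hy => ?_)
        rw [norm_smul]
        exact mul_le_mul_of_nonneg_right hy (norm_nonneg _)
    _ = A * ∫ y, ‖k y‖ := by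
        rw [integral_const_mul, integral_sub_left_eq_self (fun y => ‖k y‖) volume x]

/-- For a bounded density the potential `W * ρ` is differentiable, with derivative `∇W * ρ`. -/
lemma hasFDerivAt_conv (hd : 1 ≤ d) (h1 : W1 W ω) (h2 : W2 d ω) (h4 : W4 ω) (hρ : Integrable ρ)
    (hA : ∀ᵐ x, ‖ρ x‖ ≤ A) (x : Space d) :
    HasFDerivAt (conv W ρ) (∫ y, ρ y • fderiv ℝ W (x - y)) x := by
  have hW := integrable_kernel hd h1 h2 h4
  have hdW := integrable_fderiv_kernel hd h1 h2 h4
  have hA0 : 0 ≤ A := by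
    obtain ⟨y, hy⟩ := hA.exists
    exact (norm_nonneg _).trans hy
  have hdWn : ∀ n, Integrable (fderiv ℝ (truncKernel d ω n)) := fun n =>
    ((contDiff_truncKernel hd h1 n).continuous_fderiv one_ne_zero).integrable_of_hasCompactSupport
      ((hasCompactSupport_truncKernel h4 n).fderiv ℝ)
  -- The singularity of ∇W(x - y) moves with x, so direct domination in y is not available. The
  -- truncated kernels are C¹ with compact support, and their convolved gradients converge uniformly
  -- with error at most A‖∇W - ∇Wₙ‖₁.
  refine hasFDerivAt_of_tendstoUniformly (l := atTop) (g := conv W ρ)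
    (g' := fun x => ∫ y, ρ y • fderiv ℝ W (x - y))
    (f := fun (n : ℕ) x => ∫ y, ρ y • truncKernel d ω n (x - y))
    (f' := fun (n : ℕ) x => ∫ y, ρ y • fderiv ℝ (truncKernel d ω n) (x - y)) ?_ ?_ ?_ x
  · rw [Metric.tendstoUniformly_iff]
    intro δ hδ
    have hlim := (tendsto_integral_fderiv_truncKernel hd h1 h2 h4).const_mul A
    rw [mul_zero] at hlim
    filter_upwards [hlim.eventually_lt_const hδ] with n hn z
    refine lt_of_le_of_lt ?_ hn
    rw [dist_eq_norm, ← integral_sub (integrable_smul_comp_sub hdW hρ.1 hA z).1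
      (integrable_smul_comp_sub (hdWn n) hρ.1 hA z).1]
    simp only [← smul_sub]
    exact (integrable_smul_comp_sub (hdW.sub (hdWn n)) hρ.1 hA z).2
  · intro n z
    have := (hasCompactSupport_truncKernel (d := d) h4 n).hasFDerivAt_convolution_right
      (ContinuousLinearMap.lsmul ℝ ℝ) (μ := volume) hρ.locallyIntegrable
      (contDiff_truncKernel hd h1 n) z
    convert! this using 1
  · intro z
    have hne : ∀ᵐ y : Space d, y ≠ z := by
      have : Nonempty (Fin d) := ⟨⟨0, hd⟩⟩
      exact Measure.ae_ne volume z
    have hcomm : conv W ρ z = ∫ y, ρ y * W (z - y) := by simp only [conv, mul_comm]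
    rw [hcomm]
    simp only [smul_eq_mul]
    refine tendsto_integral_of_dominated_convergence (fun y => ‖ρ y * W (z - y)‖) (fun n => ?_)
      (integrable_smul_comp_sub hW hρ.1 hA z).1.norm (fun n => ?_) ?_
    · exact hρ.1.mul ((contDiff_truncKernel hd h1 n).continuous.comp
        (continuous_const.sub continuous_id)).aestronglyMeasurable
    · filter_upwards [hne] with y hy
      rw [norm_mul, norm_mul]
      exact mul_le_mul_of_nonneg_left
        (abs_truncKernel_le hd h1 h4 n (sub_ne_zero.2 hy.symm)) (norm_nonneg _)
    · filter_upwards [hne] with y hy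
      exact (tendsto_truncKernel hd h1 h4 (sub_ne_zero.2 hy.symm)).const_mul _

lemma integrable_gradient (hW : Integrable (fderiv ℝ W)) : Integrable (gradient W) := by
  refine (integrable_norm_iff ?_).1 (hW.norm.congr (Eventually.of_forall fun x => ?_))
  · exact ((InnerProductSpace.toDual ℝ (Space d)).symm.continuous.measurable.comp
      (measurable_fderiv ℝ W)).aestronglyMeasurable
  · simp [gradient]

/-- The gradient of the potential is `∇W * ρ`. -/
lemma gradient_conv (hd : 1 ≤ d) (h1 : W1 W ω) (h2 : W2 d ω) (h4 : W4 ω) (hρ : Integrable ρ)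
    (hA : ∀ᵐ x, ‖ρ x‖ ≤ A) (x : Space d) : gradient (conv W ρ) x = gradConv W ρ x := by
  have hdW := integrable_fderiv_kernel hd h1 h2 h4
  refine ext_inner_left ℝ fun v => ?_
  rw [real_inner_comm, inner_gradient_left, (hasFDerivAt_conv hd h1 h2 h4 hρ hA x).fderiv,
    gradConv, ← integral_inner (integrable_smul_comp_sub (integrable_gradient hdW) hρ.1 hA x).1,
    ContinuousLinearMap.integral_apply (integrable_smul_comp_sub hdW hρ.1 hA x).1]
  refine integral_congr_ae (Eventually.of_forall fun y => ?_)
  simp only [smul_apply, inner_smul_right, smul_eq_mul]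
  rw [real_inner_comm, inner_gradient_left]

end Regularity

/-- Only y = 0 is delicate: there the function is dominated by |y|^p, whose derivative at 0 vanishes
since p > 1. This is what removes any separate analysis at the free boundary. -/
lemma hasDerivAt_max_rpow {p : ℝ} (hp : 1 < p) (y : ℝ) :
    HasDerivAt (fun y : ℝ => max y 0 ^ p) (p * max y 0 ^ (p - 1)) y := by
  have hp0 : p ≠ 0 := by linarith
  rcases lt_trichotomy y 0 with hy | rfl | hy
  · rw [max_eq_right hy.le, Real.zero_rpow (by linarith), mul_zero]
    refine (hasDerivAt_const y (0 : ℝ)).congr_of_eventuallyEq ?_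
    filter_upwards [Iio_mem_nhds hy] with z hz
    rw [max_eq_right (le_of_lt hz), Real.zero_rpow hp0]
  · have habs := hasDerivAt_abs_rpow 0 hp
    rw [hasDerivAt_iff_isLittleO] at habs ⊢
    refine Asymptotics.IsBigO.trans_isLittleO (Asymptotics.IsBigO.of_bound 1 ?_) habs
    refine Eventually.of_forall fun z => ?_
    simp only [max_self, abs_zero, Real.zero_rpow hp0, Real.zero_rpow (sub_ne_zero.2 hp.ne'),
      mul_zero, smul_zero, sub_zero, one_mul, Real.norm_eq_abs]
    refine abs_le_abs_of_nonneg (Real.rpow_nonneg (le_max_right _ _) _)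
      (Real.rpow_le_rpow (le_max_right _ _) (max_le (le_abs_self z) (abs_nonneg z)) (by linarith))
  · rw [max_eq_left hy.le]
    refine (Real.hasDerivAt_rpow_const (Or.inl hy.ne')).congr_of_eventuallyEq ?_
    filter_upwards [Ioi_mem_nhds hy] with z hz
    rw [max_eq_left (le_of_lt hz)]

/-! ### Weak gradients from classical ones -/

section WeakGradient

variable {d : ℕ}

lemma memL2loc_of_bound {F : Type*} [NormedAddCommGroup F] {u : Space d → F} {C : ℝ}
    (hu : AEStronglyMeasurable u) (hC : ∀ᵐ x, ‖u x‖ ≤ C) : MemL2loc u := by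
  intro K hK
  have : IsFiniteMeasure (volume.restrict K) := ⟨by simpa using hK.measure_lt_top⟩
  exact MemLp.of_bound hu.restrict C (ae_restrict_of_ae hC)

lemma locallyIntegrable_of_bound {F : Type*} [NormedAddCommGroup F] {u : Space d → F} {C : ℝ}
    (hu : AEStronglyMeasurable u) (hC : ∀ᵐ x, ‖u x‖ ≤ C) : LocallyIntegrable u := by
  refine (locallyIntegrable_const C).mono hu (hC.mono fun x hx => hx.trans (le_abs_self C))

lemma IsTest.continuous {φ : Space d → ℝ} (hφ : IsTest φ) : Continuous φ := hφ.1.continuous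

lemma IsTest.integrable {φ : Space d → ℝ} (hφ : IsTest φ) : Integrable φ :=
  hφ.continuous.integrable_of_hasCompactSupport hφ.2

lemma IsTest.integrable_fderiv {φ : Space d → ℝ} (hφ : IsTest φ) : Integrable (fderiv ℝ φ) :=
  (hφ.1.continuous_fderiv (by simp)).integrable_of_hasCompactSupport (hφ.2.fderiv ℝ)

/-- A function that agrees almost everywhere with a differentiable function, both it and the
gradient of the latter being essentially bounded, has that gradient as weak gradient. -/
lemma hasWeakGradient_of_ae_eq {u v : Space d → ℝ} {G : Space d → Space d} {C D : ℝ}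
    (huv : u =ᵐ[volume] v) (hv : Differentiable ℝ v) (hG : gradient v =ᵐ[volume] G)
    (hu : ∀ᵐ x, ‖u x‖ ≤ C) (hGb : ∀ᵐ x, ‖G x‖ ≤ D) : HasWeakGradient u G := by
  have hvm : AEStronglyMeasurable v := hv.continuous.aestronglyMeasurable
  have hum : AEStronglyMeasurable u := hvm.congr huv.symm
  have hgm : AEStronglyMeasurable (gradient v) :=
    ((InnerProductSpace.toDual ℝ (Space d)).symm.continuous.measurable.comp
      (measurable_fderiv ℝ v)).aestronglyMeasurable
  have hGm : AEStronglyMeasurable G := hgm.congr hG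
  refine ⟨locallyIntegrable_of_bound hum hu, locallyIntegrable_of_bound hGm hGb,
    fun φ hφ => ?_⟩
  have hvb : ∀ᵐ x, ‖v x‖ ≤ C := by
    filter_upwards [hu, huv] with x h1 h2
    rwa [← h2]
  have hgb : ∀ᵐ x, ‖gradient v x‖ ≤ D := by
    filter_upwards [hGb, hG] with x h1 h2
    rwa [h2]
  have hl : ∫ x, u x • gradient φ x = ∫ x, v x • gradient φ x :=
    integral_congr_ae (huv.mono fun x hx => by simp only [hx])
  have hr : ∫ x, φ x • G x = ∫ x, φ x • gradient v x :=
    integral_congr_ae (hG.mono fun x hx => by simp only [hx])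
  have hi1 : Integrable fun x => v x • gradient φ x :=
    (integrable_gradient hφ.integrable_fderiv).bdd_smul C hvm hvb
  have hi2 : Integrable fun x => φ x • gradient v x := hφ.integrable.smul_bdd D hgm hgb
  rw [hl, hr]
  refine ext_inner_left ℝ fun w => ?_
  rw [inner_neg_right, ← integral_inner hi1, ← integral_inner hi2]
  have e1 : ∀ x, inner ℝ w (v x • gradient φ x) = v x * fderiv ℝ φ x w := fun x => by
    rw [inner_smul_right, real_inner_comm, inner_gradient_left]
  have e2 : ∀ x, inner ℝ w (φ x • gradient v x) = fderiv ℝ v x w * φ x := fun x => by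
    rw [inner_smul_right, real_inner_comm, inner_gradient_left, mul_comm]
  have hj1 := hi1.const_inner (𝕜 := ℝ) w
  have hj2 := hi2.const_inner (𝕜 := ℝ) w
  simp only [e1, e2] at hj1 hj2 ⊢
  -- Integration by parts needs v only differentiable, with the three products integrable;
  -- continuity of its gradient plays no role.
  exact integral_mul_fderiv_eq_neg_fderiv_mul_of_integrable hj2 hj1
    (hφ.integrable.bdd_mul hvm hvb) (fun x _ => hv x)
    fun x _ => (hφ.1.differentiable (by simp)) x

end WeakGradient

/-! ### Boundedness of minimizers and the gradient of the pressure -/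

section Stationary

variable {d : ℕ} {ε m M A : ℝ} {W ρ : Space d → ℝ} {ω : ℝ → ℝ}

/-- A minimizer of the energy is essentially bounded. -/
lemma IsGlobalMinimizer.exists_ae_norm_le (hd : 1 ≤ d) (hε : 0 < ε) (hm : 2 < m) (hM : 0 < M)
    (h1 : W1 W ω) (h2 : W2 d ω) (h4 : W4 ω) (hρ : IsGlobalMinimizer ε m M W ρ) :
    ∃ A : ℝ, 0 ≤ A ∧ ∀ᵐ x, ‖ρ x‖ ≤ A := by
  have hW := integrable_kernel hd h1 h2 h4
  obtain ⟨Λ, hΛ, hEL⟩ := exists_rpow_eq_max hd hε hm hM hW h1.even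
    (fun x hx => kernel_nonpos hd h1 h4 hx) hρ
  have hκ : 0 < ε * m / (m - 1) := div_pos (mul_pos hε (by linarith)) (by linarith)
  refine AggDiff.exists_ae_norm_le (a := m - 1) (m := m) (c := (ε * m / (m - 1))⁻¹) h1.measurable hW
    (by linarith) (by linarith) (inv_nonneg.2 hκ.le) hρ.1.1 hρ.1.2.2.1 ?_
  filter_upwards [hEL] with x hx
  rw [hx, inv_mul_eq_div]
  refine max_le (div_le_div_of_nonneg_right ?_ hκ.le) (div_nonneg (abs_nonneg _) hκ.le)
  -- Λ ≤ 0 is essential: it gives Λ - W*ρ ≤ |W*ρ| with no additive constant, as the homogeneous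
  -- bootstrap requires.
  linarith [neg_abs_le (conv W ρ x)]

/-- The weak gradient of the pressure `ρ^m` of a bounded minimizer. -/
lemma IsGlobalMinimizer.hasWeakGradient (hd : 1 ≤ d) (hε : 0 < ε) (hm : 2 < m) (hM : 0 < M)
    (h1 : W1 W ω) (h2 : W2 d ω) (h4 : W4 ω) (hρ : IsGlobalMinimizer ε m M W ρ) (hA0 : 0 ≤ A)
    (hA : ∀ᵐ x, ‖ρ x‖ ≤ A) :
    HasWeakGradient (fun x => ρ x ^ m) fun x => -(ε⁻¹ • ρ x • gradConv W ρ x) := by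
  have hW := integrable_kernel hd h1 h2 h4
  have hdW := integrable_fderiv_kernel hd h1 h2 h4
  have hρ1 := hρ.1.2.1
  obtain ⟨Λ, -, hEL⟩ := exists_rpow_eq_max hd hε hm hM hW h1.even
    (fun x hx => kernel_nonpos hd h1 h4 hx) hρ
  have hm1 : 0 < m - 1 := by linarith
  have hκ : 0 < ε * m / (m - 1) := div_pos (mul_pos hε (by linarith)) hm1
  have hpκ : m / (m - 1) * (ε * m / (m - 1))⁻¹ = ε⁻¹ := by
    have : m ≠ 0 := by linarith
    field_simp
  set κ := ε * m / (m - 1)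
  set p := m / (m - 1) with hp
  have hp1 : 1 < p := by rw [hp, one_lt_div hm1]; linarith
  have hp2 : p - 1 = (m - 1)⁻¹ := by rw [hp]; field_simp; ring
  -- v is the everywhere differentiable representative of ρ^m, obtained by raising the
  -- Euler–Lagrange formula for ρ^(m-1) to the power p.
  let v : Space d → ℝ := fun x => max ((Λ - conv W ρ x) / κ) 0 ^ p
  have hv : ∀ x, HasFDerivAt v ((p * max ((Λ - conv W ρ x) / κ) 0 ^ (p - 1)) •
      (κ⁻¹ • -fderiv ℝ (conv W ρ) x)) x := by
    intro x
    have hu : HasFDerivAt (conv W ρ) (fderiv ℝ (conv W ρ) x) x :=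
      (hasFDerivAt_conv hd h1 h2 h4 hρ1 hA x).differentiableAt.hasFDerivAt
    have hl : HasFDerivAt (fun x => (Λ - conv W ρ x) / κ) (κ⁻¹ • -fderiv ℝ (conv W ρ) x) x := by
      simpa only [div_eq_inv_mul, smul_eq_mul] using (hu.const_sub Λ).const_mul κ⁻¹
    exact (hasDerivAt_max_rpow hp1 _).comp_hasFDerivAt x hl
  refine hasWeakGradient_of_ae_eq (v := v) (C := A ^ m)
    (D := ε⁻¹ * (A * (A * ∫ y, ‖gradient W y‖))) ?_ (fun x => (hv x).differentiableAt) ?_ ?_ ?_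
  · filter_upwards [hEL, hρ.1.1] with x hx h0
    have h0' : 0 ≤ ρ x := h0
    simp only [v]
    rw [← hx, ← Real.rpow_mul h0', hp, mul_div_cancel₀ _ hm1.ne']
  -- In the chain rule the factor max(·, 0)^(p-1) equals (ρ^(m-1))^(1/(m-1)) = ρ, and the constants
  -- combine to p/κ = 1/ε.
  · filter_upwards [hEL, hρ.1.1] with x hx h0
    have h0' : 0 ≤ ρ x := h0
    refine ext_inner_left ℝ fun w => ?_
    rw [real_inner_comm, inner_gradient_left, (hv x).fderiv, ← hx, hp2,
      Real.rpow_rpow_inv h0' hm1.ne', ← gradient_conv hd h1 h2 h4 hρ1 hA x, inner_neg_right,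
      inner_smul_right, inner_smul_right, real_inner_comm, inner_gradient_left, ← hpκ]
    simp only [smul_apply, neg_apply, smul_eq_mul]
    ring
  · filter_upwards [hA, hρ.1.1] with x hx h0
    have h0' : 0 ≤ ρ x := h0
    rw [Real.norm_of_nonneg (Real.rpow_nonneg h0' _)]
    rw [Real.norm_of_nonneg h0'] at hx
    exact Real.rpow_le_rpow h0' hx (by linarith)
  · filter_upwards [hA] with x hx
    rw [norm_neg, norm_smul, norm_smul, Real.norm_of_nonneg (inv_nonneg.2 hε.le)]
    refine mul_le_mul_of_nonneg_left ?_ (inv_nonneg.2 hε.le)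
    exact mul_le_mul hx (integrable_smul_comp_sub (integrable_gradient hdW) hρ1.1 hA x).2
      (norm_nonneg _) hA0

end Stationary

end AggDiff

end

theorem theorem2p7 (d : ℕ) (hd : 1 ≤ d) (ε m M : ℝ) (hε : 0 < ε) (hm : 2 < m) (hM : 0 < M)
    (W : AggDiff.Space d → ℝ) (ω : ℝ → ℝ)
    (hW1 : AggDiff.W1 W ω) (hW2 : AggDiff.W2 d ω) (hW4 : AggDiff.W4 ω)
    (ρ : AggDiff.Space d → ℝ) (hρ : AggDiff.IsGlobalMinimizer ε m M W ρ)
    (hconn : IsConnected (AggDiff.essSupport ρ)) :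
    AggDiff.IsStationaryState ε m W ρ := by
  obtain ⟨A, hA0, hA⟩ := hρ.exists_ae_norm_le hd hε hm hM hW1 hW2 hW4
  have hweak := hρ.hasWeakGradient hd hε hm hM hW1 hW2 hW4 hA0 hA
  have hρ1 := hρ.1.2.1
  have hgW := AggDiff.integrable_gradient (AggDiff.integrable_fderiv_kernel hd hW1 hW2 hW4)
  have hgrad : gradient (AggDiff.conv W ρ) = AggDiff.gradConv W ρ :=
    funext fun x => AggDiff.gradient_conv hd hW1 hW2 hW4 hρ1 hA x
  -- Measurability comes from identifying ∇W*ρ with the gradient of the potential, since derivatives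
  -- are measurable.
  have hGm : AEStronglyMeasurable (AggDiff.gradConv W ρ) := by
    rw [← hgrad]
    exact ((InnerProductSpace.toDual ℝ (AggDiff.Space d)).symm.continuous.measurable.comp
      (measurable_fderiv ℝ _)).aestronglyMeasurable
  have hGb : ∀ x, ‖AggDiff.gradConv W ρ x‖ ≤ A * ∫ y, ‖gradient W y‖ := fun x =>
    (AggDiff.integrable_smul_comp_sub hgW hρ1.1 hA x).2
  have hfm : AEStronglyMeasurable fun x => ρ x • AggDiff.gradConv W ρ x := hρ1.1.smul hGm
  have hfb : ∀ᵐ x, ‖ρ x • AggDiff.gradConv W ρ x‖ ≤ A * (A * ∫ y, ‖gradient W y‖) := by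
    filter_upwards [hA] with x hx
    rw [norm_smul]
    exact mul_le_mul hx (hGb x) (norm_nonneg _) hA0
  refine ⟨hρ.1.1, hρ1, ⟨?_, _, ?_, hweak⟩, Eventually.of_forall fun x =>
    (AggDiff.integrable_smul_comp_sub hgW hρ1.1 hA x).1,
    AggDiff.locallyIntegrable_of_bound hGm (Eventually.of_forall hGb),
    AggDiff.locallyIntegrable_of_bound hfm hfb, fun φ hφ => ?_⟩
  · refine AggDiff.memL2loc_of_bound (C := A ^ m) hweak.1.aestronglyMeasurable ?_
    filter_upwards [hA] with x hx
    exact (Real.abs_rpow_le_abs_rpow _ _).trans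
      (Real.rpow_le_rpow (abs_nonneg _) hx (by linarith))
  · refine AggDiff.memL2loc_of_bound (C := ε⁻¹ * (A * (A * ∫ y, ‖gradient W y‖)))
      hweak.2.1.aestronglyMeasurable ?_
    filter_upwards [hfb] with x hx
    rw [norm_neg, norm_smul, Real.norm_of_nonneg (inv_nonneg.2 hε.le)]
    exact mul_le_mul_of_nonneg_left hx (inv_nonneg.2 hε.le)
  · rw [hweak.2.2 φ hφ]
    simp only [smul_neg, integral_neg, neg_neg, smul_comm _ ε⁻¹, integral_smul]
    rw [inv_smul_smul₀ hε.ne']
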